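/- Let $E=(E^0,E^1,s,r)$ be a finite directed graph with at least one vertex (loops and parallel edges are allowed; $s(e)$ and $r(e)$ are the source and range of an edge $e$), and let $K$ be any field. Let $C_K(E)$ be the Cohn path algebra of $E$: the $K$-algebra generated by the vertices $v\in E^0$, the edges $e\in E^1$ and symbols $e^*$ $(e\in E^1)$ subject to the relations, for all $v,w\in E^0$ and $e,f\in E^1$, $$vw=\delta_{v,w}w,\qquad s(e)e=e=e\,r(e),\qquad r(e)e^*=e^*=e^*s(e),\qquad e^*f=\delta_{e,f}\,r(e);$$ it is unital with identity $1=\sum_{v\in E^0}v$. Write $R=C_K(E)$. Then the following are equivalent: 1. $R$ has cancellation of projectives: for all finitely generated projective right $R$-modules $P$ and $P'$, if $P\oplus R\cong P'\oplus R$ then $P\cong P'$. 2. $R$ is a Hermite ring: for all integers $m,n\ge 1$ and every right $R$-module $M$, if $R^n\cong R^m\oplus M$ as right $R$-modules, then $n\ge m$ and $M\cong R^{n-m}$. 3. $R$ is stably finite: for every integer $n\ge 1$ and every right $R$-module $M$, if $R^n\cong R^n\oplus M$ as right $R$-modules, then $M=0$. 4. $R$ is directly finite: for all $a,b\in R$,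 if $ab=1$ then $ba=1$. 5. $E$ is acyclic: there is no sequence of edges $e_1,\dots,e_n$ $(n\ge 1)$ with $r(e_i)=s(e_{i+1})$ for $1\le i<n$, $r(e_n)=s(e_1)$ and $s(e_1),\dots,s(e_n)$ distinct. -/

import Mathlib

universe u v w

/-! ### Directed graphs -/

/-- A directed graph with vertex set `V` and edge set `E`: every edge has a source and a range.
Loops and parallel edges are allowed. -/
structure DirectedGraph (V : Type u) (E : Type v) where
  /-- the source of an edge -/
  s : E → V
  /-- the range of an edge -/
  r : E → V

namespace DirectedGraph

variable {V : Type u} {E : Type v}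

/-- `e₁ ⋯ eₙ` with `n ≥ 1` is a closed path: `r(eᵢ) = s(eᵢ₊₁)` for `1 ≤ i < n`
and `r(eₙ) = s(e₁)`. -/
def IsClosedPath (G : DirectedGraph V E) (p : List E) : Prop :=
  p.IsChain (fun e f => G.r e = G.s f) ∧ ∃ h : p ≠ [], G.r (p.getLast h) = G.s (p.head h)

/-- A cycle is a closed path `e₁ ⋯ eₙ` whose vertices `s(e₁), …, s(eₙ)` are distinct. -/
def IsCycle (G : DirectedGraph V E) (p : List E) : Prop :=
  G.IsClosedPath p ∧ (p.map G.s).Nodup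

/-- A graph is acyclic if it has no cycles. -/
def IsAcyclic (G : DirectedGraph V E) : Prop :=
  ¬ ∃ p : List E, G.IsCycle p

/-! ### Cohn path algebras -/

/-- The generators of the Cohn path algebra: the vertices, the edges, and a symbol `e*` for
every edge `e`. -/
inductive CohnGen (V : Type u) (E : Type v) : Type (max u v)
  | vertex : V → CohnGen V E
  | edge : E → CohnGen V E
  | ghost : E → CohnGen V E

section Cohn

variable (K : Type w) [Field K]

/-- A vertex, as an element of the free algebra on the generators. -/
def freeVertex (x : V) : FreeAlgebra K (CohnGen V E) := FreeAlgebra.ι K (CohnGen.vertex x)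

/-- An edge `e`, as an element of the free algebra on the generators. -/
def freeEdge (e : E) : FreeAlgebra K (CohnGen V E) := FreeAlgebra.ι K (CohnGen.edge e)

/-- The symbol `e*`, as an element of the free algebra on the generators. -/
def freeGhost (e : E) : FreeAlgebra K (CohnGen V E) := FreeAlgebra.ι K (CohnGen.ghost e)

/-- The defining relations of the Cohn path algebra of a graph with finitely many vertices.

The last relation says that the unit of the free *unital* algebra is the sum of the vertices.
It is there because the algebra is presented by the other relations as an algebra not assumed to
be unital; in that algebra the sum of the (finitely many) vertices is an identity element, by
those same relations, so the two presentations define the same algebra. -/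
inductive CohnRel [Fintype V] (G : DirectedGraph V E) :
    FreeAlgebra K (CohnGen V E) → FreeAlgebra K (CohnGen V E) → Prop
  | vertex_mul_self (x : V) : CohnRel G (freeVertex K x * freeVertex K x) (freeVertex K x)
  | vertex_mul_of_ne (x y : V) (h : x ≠ y) : CohnRel G (freeVertex K x * freeVertex K y) 0
  | source_mul_edge (e : E) : CohnRel G (freeVertex K (G.s e) * freeEdge K e) (freeEdge K e)
  | edge_mul_range (e : E) : CohnRel G (freeEdge K e * freeVertex K (G.r e)) (freeEdge K e)
  | range_mul_ghost (e : E) : CohnRel G (freeVertex K (G.r e) * freeGhost K e) (freeGhost K e)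
  | ghost_mul_source (e : E) : CohnRel G (freeGhost K e * freeVertex K (G.s e)) (freeGhost K e)
  | ghost_mul_edge_self (e : E) : CohnRel G (freeGhost K e * freeEdge K e) (freeVertex K (G.r e))
  | ghost_mul_edge_of_ne (e f : E) (h : e ≠ f) : CohnRel G (freeGhost K e * freeEdge K f) 0
  | sum_vertex : CohnRel G (∑ x : V, freeVertex K x) 1

/-- The Cohn path algebra `C_K(G)` of a graph with finitely many vertices. -/
def CohnPathAlgebra [Fintype V] (G : DirectedGraph V E) : Type (max u v w) :=
  RingQuot (CohnRel K G)

noncomputable instance [Fintype V] (G : DirectedGraph V E) : Ring (CohnPathAlgebra K G) :=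
  inferInstanceAs (Ring (RingQuot (CohnRel K G)))

noncomputable instance [Fintype V] (G : DirectedGraph V E) : Algebra K (CohnPathAlgebra K G) :=
  inferInstanceAs (Algebra K (RingQuot (CohnRel K G)))

end Cohn

end DirectedGraph

/-! ### Cancellation properties of rings

Right `R`-modules are modules over the opposite ring `Rᵐᵒᵖ`, and `R^n` is `Fin n → R` with the
right multiplication. The modules range over the universe of `R`; all modules concerned are
finitely generated, so this is no restriction up to isomorphism. -/

/-- `R` is stably finite: for all `n ≥ 1`, `R^n ≅ R^n ⊕ M` as right `R`-modules implies `M = 0`. -/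
def IsStablyFinite (R : Type u) [Ring R] : Prop :=
  ∀ (n : ℕ) (_ : 0 < n) (M : Type u) [AddCommGroup M] [Module Rᵐᵒᵖ M],
    Nonempty ((Fin n → R) ≃ₗ[Rᵐᵒᵖ] (Fin n → R) × M) → Subsingleton M

/-- `R` is a Hermite ring: for all `m, n ≥ 1` and every right `R`-module `M`,
`R^n ≅ R^m ⊕ M` implies `n ≥ m` and `M ≅ R^(n-m)`. -/
def IsHermiteRing (R : Type u) [Ring R] : Prop :=
  ∀ (m n : ℕ) (_ : 0 < m) (_ : 0 < n) (M : Type u) [AddCommGroup M] [Module Rᵐᵒᵖ M],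
    Nonempty ((Fin n → R) ≃ₗ[Rᵐᵒᵖ] (Fin m → R) × M) →
      m ≤ n ∧ Nonempty (M ≃ₗ[Rᵐᵒᵖ] (Fin (n - m) → R))

/-- `R` has cancellation of projectives: for all finitely generated projective right `R`-modules
`P` and `Q`, `P ⊕ R ≅ Q ⊕ R` implies `P ≅ Q`. -/
def HasCancellationOfProjectives (R : Type u) [Ring R] : Prop :=
  ∀ (P Q : Type u) [AddCommGroup P] [Module Rᵐᵒᵖ P] [AddCommGroup Q] [Module Rᵐᵒᵖ Q],
    Module.Finite Rᵐᵒᵖ P → Module.Projective Rᵐᵒᵖ P →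
    Module.Finite Rᵐᵒᵖ Q → Module.Projective Rᵐᵒᵖ Q →
      Nonempty ((P × R) ≃ₗ[Rᵐᵒᵖ] (Q × R)) → Nonempty (P ≃ₗ[Rᵐᵒᵖ] Q)

/-! The implications 1 → 2 → 3 → 4 are formal for any nonzero ring. The graph enters in the other
two. 4 → 5: a closed path based at `x` gives `c`, `d` with `d * c = x`. Hence `d + (1 - x)` is a
left inverse of `c + (1 - x)`, and direct finiteness forces `x = c * d`. The right side is a
multiple of some `e*` on the left, and on the path representation every `e*` kills the empty word at
`x`, while `x` fixes it (`vertex_ne_mul_ghost`). 5 → 1: the gaps `q x = x - ∑ e e*` satisfy `q x * e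
= 0` and `e* * q x = 0`, so `q x R q y` is zero for `x ≠ y` and consists of scalar multiples of `q
x` for `x = y`. If the graph is acyclic, well-founded induction along the edges puts every vertex in
the ideal generated by the gaps (`vertex_mem_span_gap`). Thus R is a split semisimple algebra, whose
finitely generated modules are classified by the dimensions of their corners
(`IsSplitFamily.nonempty_linearEquiv`). These are additive natural numbers, so they cancel. -/

/-! ### Implications between the cancellation properties -/

section CancellationProperties

variable {R : Type u} [Ring R]

/-- A ring is free of rank one as a right module over itself. -/
def opSelfEquiv (R : Type u) [Ring R] : Rᵐᵒᵖ ≃ₗ[Rᵐᵒᵖ] R where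
  toFun := MulOpposite.unop
  invFun := MulOpposite.op
  map_add' _ _ := rfl
  map_smul' _ _ := rfl
  left_inv _ := rfl
  right_inv _ := rfl

instance finite_op_self : Module.Finite Rᵐᵒᵖ R := Module.Finite.equiv (opSelfEquiv R)

instance free_op_self : Module.Free Rᵐᵒᵖ R := Module.Free.of_equiv (opSelfEquiv R)

lemma HasCancellationOfProjectives.cancel_free (h : HasCancellationOfProjectives R) (k : ℕ) :
    ∀ (P Q : Type u) [AddCommGroup P] [Module Rᵐᵒᵖ P] [AddCommGroup Q] [Module Rᵐᵒᵖ Q],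
    Module.Finite Rᵐᵒᵖ P → Module.Projective Rᵐᵒᵖ P →
    Module.Finite Rᵐᵒᵖ Q → Module.Projective Rᵐᵒᵖ Q →
      Nonempty ((P × (Fin k → R)) ≃ₗ[Rᵐᵒᵖ] (Q × (Fin k → R))) →
      Nonempty (P ≃ₗ[Rᵐᵒᵖ] Q) := by
  induction k with
  | zero =>
    rintro P Q _ _ _ _ - - - - ⟨e⟩
    exact ⟨LinearEquiv.prodUnique.symm.trans (e.trans LinearEquiv.prodUnique)⟩
  | succ k ih =>
    intro P Q _ _ _ _ hP hP' hQ hQ' ⟨e⟩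
    have split : ∀ (M : Type u) [AddCommGroup M] [Module Rᵐᵒᵖ M],
        Nonempty ((M × (Fin (k + 1) → R)) ≃ₗ[Rᵐᵒᵖ] ((M × (Fin k → R)) × R)) := by
      intro M _ _
      exact ⟨((LinearEquiv.refl Rᵐᵒᵖ M).prodCongr
        ((Fin.consLinearEquiv Rᵐᵒᵖ (fun _ : Fin (k + 1) => R)).symm.trans
          (LinearEquiv.prodComm Rᵐᵒᵖ R (Fin k → R)))).trans
        (LinearEquiv.prodAssoc Rᵐᵒᵖ M (Fin k → R) R).symm⟩
    obtain ⟨e₁⟩ := split P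
    obtain ⟨e₂⟩ := split Q
    exact ih P Q hP hP' hQ hQ'
      (h _ _ inferInstance inferInstance inferInstance inferInstance
        ⟨e₁.symm.trans (e.trans e₂)⟩)

lemma nonempty_pi_fin_add_equiv_prod (R : Type u) [Ring R] (m k : ℕ) :
    Nonempty ((Fin (m + k) → R) ≃ₗ[Rᵐᵒᵖ] ((Fin m → R) × (Fin k → R))) :=
  ⟨(LinearEquiv.funCongrLeft Rᵐᵒᵖ R finSumFinEquiv).trans
    (LinearEquiv.sumArrowLequivProdArrow (Fin m) (Fin k) Rᵐᵒᵖ R)⟩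

lemma HasCancellationOfProjectives.isHermiteRing [Nontrivial R]
    (h : HasCancellationOfProjectives R) : IsHermiteRing R := by
  rintro m n hm hn M _ _ ⟨e⟩
  have hfin : Module.Finite Rᵐᵒᵖ M :=
    Module.Finite.of_surjective ((LinearMap.snd Rᵐᵒᵖ (Fin m → R) M) ∘ₗ e.toLinearMap)
      (Prod.snd_surjective.comp e.surjective)
  have hproj : Module.Projective Rᵐᵒᵖ M :=
    Module.Projective.of_split (e.symm.toLinearMap ∘ₗ LinearMap.inr Rᵐᵒᵖ (Fin m → R) M)
      ((LinearMap.snd Rᵐᵒᵖ (Fin m → R) M) ∘ₗ e.toLinearMap) (by ext; simp)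
  rcases le_total m n with hmn | hnm
  · refine ⟨hmn, ?_⟩
    obtain ⟨k, rfl⟩ := Nat.exists_eq_add_of_le hmn
    obtain ⟨f⟩ := nonempty_pi_fin_add_equiv_prod R m k
    rw [Nat.add_sub_cancel_left]
    exact h.cancel_free m M (Fin k → R) hfin hproj inferInstance inferInstance
      ⟨(LinearEquiv.prodComm _ _ _).trans (e.symm.trans (f.trans (LinearEquiv.prodComm _ _ _)))⟩
  · obtain ⟨k, rfl⟩ := Nat.exists_eq_add_of_le hnm
    obtain ⟨f⟩ := nonempty_pi_fin_add_equiv_prod R n k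
    -- `Fin 0 → R` plays the zero module: cancelling `R^n` from `R^n ≅ R^n ⊕ R^k ⊕ M` leaves `R^k ⊕
    -- M ≅ 0`, and nontriviality of `R` then forces `k = 0`.
    obtain ⟨g⟩ := h.cancel_free n (Fin 0 → R) ((Fin k → R) × M) inferInstance inferInstance
      inferInstance inferInstance
      ⟨LinearEquiv.uniqueProd.trans (e.trans ((f.prodCongr (LinearEquiv.refl _ M)).trans
        ((LinearEquiv.prodAssoc _ _ _ _).trans (LinearEquiv.prodComm _ _ _))))⟩
    have hk : k = 0 := by
      by_contra hk
      have : Nonempty (Fin k) := ⟨⟨0, Nat.pos_of_ne_zero hk⟩⟩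
      obtain ⟨x, hx⟩ := exists_ne (0 : Fin k → R)
      refine hx ?_
      have h0 : ((x, 0) : (Fin k → R) × M) = 0 := g.symm.injective (Subsingleton.elim _ _)
      exact congrArg Prod.fst h0
    subst hk
    refine ⟨le_rfl, ?_⟩
    have : Subsingleton M := by
      refine ⟨fun x y => ?_⟩
      have h0 : ((0, x) : (Fin 0 → R) × M) = (0, y) := g.symm.injective (Subsingleton.elim _ _)
      exact congrArg Prod.snd h0
    have : Subsingleton (Fin (n - (n + 0)) → R) := by
      rw [Nat.add_zero, Nat.sub_self]; infer_instance
    exact ⟨LinearEquiv.ofSubsingleton _ _⟩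

lemma IsHermiteRing.isStablyFinite (h : IsHermiteRing R) : IsStablyFinite R := by
  intro n hn M _ _ e
  obtain ⟨-, ⟨f⟩⟩ := h n n hn hn M e
  have : Subsingleton (Fin (n - n) → R) := by
    rw [Nat.sub_self]; infer_instance
  exact f.injective.subsingleton

/-- If `a * b = 1`, left multiplication by `a` is split by `b`, so `R ≅ R ⊕ ker a`. The kernel must
vanish, and it contains `1 - b * a`. -/
lemma IsStablyFinite.isDedekindFiniteMonoid (h : IsStablyFinite R) :
    IsDedekindFiniteMonoid R := by
  refine ⟨fun {a b} hab => ?_⟩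
  let g : R →ₗ[Rᵐᵒᵖ] R := LinearMap.mulLeft Rᵐᵒᵖ a
  have hg : ∀ x, g (x - b * (a * x)) = 0 := by
    intro x
    simp only [g, LinearMap.mulLeft_apply, mul_sub, ← mul_assoc, hab, one_mul, sub_self]
  let e : R ≃ₗ[Rᵐᵒᵖ] R × LinearMap.ker g :=
    { toFun := fun x => (a * x, ⟨x - b * (a * x), hg x⟩)
      map_add' := fun x y => by
        ext <;> simp only [Prod.fst_add, Prod.snd_add, Submodule.coe_add, mul_add]
        abel
      map_smul' := fun r x => by
        ext <;> simp [sub_mul, mul_assoc]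
      invFun := fun y => b * y.1 + y.2
      left_inv := fun x => by simp
      right_inv := by
        rintro ⟨y, z, hz⟩
        have hz' : a * z = 0 := hz
        have hy : a * (b * y + z) = y := by rw [mul_add, hz', ← mul_assoc, hab, one_mul, add_zero]
        ext
        · exact hy
        · change b * y + z - b * (a * (b * y + z)) = z
          rw [hy]; abel }
  have hs := h 1 one_pos (LinearMap.ker g)
    ⟨(LinearEquiv.funUnique (Fin 1) Rᵐᵒᵖ R).trans
      (e.trans ((LinearEquiv.funUnique (Fin 1) Rᵐᵒᵖ R).symm.prodCongr (LinearEquiv.refl _ _)))⟩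
  have h1 := congrArg Subtype.val
    (Subsingleton.elim (⟨_, hg 1⟩ : LinearMap.ker g) 0)
  exact (sub_eq_zero.1 (by simpa using h1)).symm

end CancellationProperties

/-! ### Algebras with a full family of corners isomorphic to the base field -/

/-- A finite family of idempotents `q i` of a `K`-algebra `S` such that `q i S q j` is `0` for
`i ≠ j` and is spanned by `q i` for `i = j`, and such that the `q i` generate the unit ideal.
Such an algebra is a finite product of matrix algebras over `K`. -/
structure IsSplitFamily (K : Type w) {S : Type u} {W : Type v} [Field K] [Ring S] [Algebra K S]
    (q : W → S) : Prop where
  idem : ∀ i, q i * q i = q i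
  corner_ne : ∀ i j, i ≠ j → ∀ x, q i * x * q j = 0
  corner_self : ∀ i x, ∃ c : K, q i * x * q i = c • q i
  full : ∃ (n : ℕ) (t : Fin n → W) (a b : Fin n → S), ∑ i, a i * q (t i) * b i = 1

section Split

variable {K : Type w} {S : Type u} {W : Type v} [Field K] [Ring S] [Algebra K S] {q : W → S}

open MulOpposite in
lemma IsSplitFamily.op (h : IsSplitFamily K q) : IsSplitFamily K (fun i => op (q i)) where
  idem i := by rw [← op_mul, h.idem]
  corner_ne i j hij x := by
    rw [← op_unop x, ← op_mul, ← op_mul, ← mul_assoc, h.corner_ne _ _ hij.symm, op_zero]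
  corner_self i x := by
    obtain ⟨c, hc⟩ := h.corner_self i x.unop
    exact ⟨c, by rw [← op_unop x, ← op_mul, ← op_mul, ← mul_assoc, hc, op_smul]⟩
  full := by
    obtain ⟨n, t, a, b, hab⟩ := h.full
    refine ⟨n, t, fun i => MulOpposite.op (b i), fun i => MulOpposite.op (a i), ?_⟩
    rw [← op_one, ← hab, Finset.op_sum]
    exact Finset.sum_congr rfl fun i _ => by simp only [op_mul, mul_assoc]

/-- Writing `x = 1 * x * 1` and expanding both units by `full` leaves corner elements in the middle,
which are scalar multiples of the `q i` or zero. -/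
lemma IsSplitFamily.finite (h : IsSplitFamily K q) : Module.Finite K S := by
  classical
  obtain ⟨n, t, a, b, hab⟩ := h.full
  refine ⟨⟨Finset.univ.image fun p : Fin n × Fin n => a p.1 * q (t p.1) * b p.2, ?_⟩⟩
  rw [eq_top_iff]
  rintro x -
  have hx : x = ∑ i, ∑ j, a i * (q (t i) * (b i * x * a j) * q (t j)) * b j := by
    calc x = 1 * x * 1 := by rw [one_mul, mul_one]
      _ = _ := by
        simp only [← hab, Finset.sum_mul, Finset.mul_sum, mul_assoc]
        rw [Finset.sum_comm]
  rw [hx]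
  refine Submodule.sum_mem _ fun i _ => Submodule.sum_mem _ fun j _ => ?_
  by_cases hij : t i = t j
  · obtain ⟨c, hc⟩ := h.corner_self (t i) (b i * x * a j)
    rw [← hij, hc, mul_smul_comm, smul_mul_assoc]
    exact Submodule.smul_mem _ _ (Submodule.subset_span (by
      simp only [Finset.coe_image, Finset.coe_univ, Set.image_univ, Set.mem_range, Prod.exists]
      exact ⟨i, j, rfl⟩))
  · rw [h.corner_ne _ _ hij]
    simp

variable {P Q T : Type*} [AddCommGroup P] [Module S P] [Module K P] [IsScalarTower K S P]
  [AddCommGroup Q] [Module S Q] [Module K Q] [IsScalarTower K S Q]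
  [AddCommGroup T] [Module S T] [Module K T] [IsScalarTower K S T]

variable (K P) in
/-- The corner `x P` of a module `P`. -/
def moduleCorner (x : S) : Submodule K P :=
  LinearMap.range (Algebra.lsmul K K P x)

lemma finrank_moduleCorner_prod [Module.Finite K P] [Module.Finite K T] (x : S) :
    Module.finrank K (moduleCorner K (P × T) x) =
      Module.finrank K (moduleCorner K P x) + Module.finrank K (moduleCorner K T x) := by
  have h : moduleCorner K (P × T) x = (moduleCorner K P x).prod (moduleCorner K T x) := by
    rw [moduleCorner, moduleCorner, moduleCorner, ← LinearMap.range_prodMap]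
    rfl
  rw [h, ← Module.finrank_prod]
  refine LinearEquiv.finrank_eq
    { toFun := fun y => (⟨y.1.1, y.2.1⟩, ⟨y.1.2, y.2.2⟩)
      invFun := fun y => ⟨(y.1, y.2), y.1.2, y.2.2⟩
      map_add' := fun _ _ => rfl
      map_smul' := fun _ _ => rfl
      left_inv := fun _ => rfl
      right_inv := fun _ => rfl }

lemma finrank_moduleCorner_congr (e : P ≃ₗ[S] Q) (x : S) :
    Module.finrank K (moduleCorner K P x) = Module.finrank K (moduleCorner K Q x) := by
  have h : moduleCorner K Q x =
      Submodule.map (e.restrictScalars K : P →ₗ[K] Q) (moduleCorner K P x) := by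
    ext y
    simp only [moduleCorner, LinearMap.mem_range, Submodule.mem_map, Algebra.lsmul_coe]
    constructor
    · rintro ⟨z, rfl⟩
      exact ⟨x • e.symm z, ⟨_, rfl⟩, by simp⟩
    · rintro ⟨_, ⟨z, rfl⟩, rfl⟩
      exact ⟨e z, by simp⟩
  rw [h]
  exact (LinearEquiv.finrank_map_eq (e.restrictScalars K) _).symm

/-- Linear maps between the corners `q i P` and `q i Q` glue to a map of `S`-modules. -/
lemma IsSplitFamily.exists_glue (h : IsSplitFamily K q) (F : W → P →ₗ[K] Q)
    (hF : ∀ i x, q i • F i x = F i x) (hF' : ∀ i x, F i (q i • x) = F i x) :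
    ∃ Φ : P →ₗ[S] Q, ∀ i x, q i • Φ x = F i x := by
  obtain ⟨n, t, a, b, hab⟩ := h.full
  -- Each `q i * s * q j` acts as a scalar multiple of `q i` or as zero, so `K`-linearity alone
  -- makes the family `F` commute with it.
  have key : ∀ i j s x, F i ((q i * s * q j) • x) = (q i * s * q j) • F j x := by
    intro i j s x
    by_cases hij : i = j
    · subst hij
      obtain ⟨c, hc⟩ := h.corner_self i s
      rw [hc, smul_assoc, smul_assoc, map_smul, hF, hF']
    · rw [h.corner_ne i j hij, zero_smul, zero_smul, map_zero]
  have expand : ∀ i s x, F i (s • x) = ∑ j, (q i * s * a j * q (t j)) • F (t j) (b j • x) := by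
    intro i s x
    rw [← hF' i (s • x)]
    conv_lhs => rw [← one_smul S x, ← hab]
    simp only [Finset.sum_smul, Finset.smul_sum, map_sum]
    refine Finset.sum_congr rfl fun j _ => ?_
    have := key i (t j) (s * a j) (b j • x)
    simp only [mul_smul] at this ⊢
    exact this
  -- The formula is forced: `Φ x = ∑ a i * q (t i) * b i • Φ x`, and `q (t i) • Φ (b i • x)` has to
  -- be `F (t i) (b i • x)`.
  let Φ : P →ₗ[S] Q :=
    { toFun := fun x => ∑ i, a i • F (t i) (b i • x)
      map_add' := fun x y => by simp only [smul_add, map_add, Finset.sum_add_distrib]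
      map_smul' := fun s x => by
        simp only [RingHom.id_apply]
        -- After this expansion the sum over `i` collapses to `∑ a i * q (t i) * b i = 1`.
        have h1 : ∀ i, a i • F (t i) (b i • s • x) =
            ∑ j, (a i * q (t i) * b i) • ((s * a j * q (t j)) • F (t j) (b j • x)) := by
          intro i
          rw [← mul_smul (b i), expand, Finset.smul_sum]
          refine Finset.sum_congr rfl fun j _ => ?_
          simp only [mul_smul]
        rw [Finset.sum_congr rfl fun i _ => h1 i, Finset.sum_comm]
        simp only [← Finset.sum_smul, hab, one_smul, Finset.smul_sum]
        refine Finset.sum_congr rfl fun j _ => ?_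
        simp only [mul_smul, hF] }
  refine ⟨Φ, fun i x => ?_⟩
  have := expand i 1 x
  rw [one_smul] at this
  rw [this]
  change q i • ∑ j, a j • F (t j) (b j • x) = _
  rw [Finset.smul_sum]
  refine Finset.sum_congr rfl fun j _ => ?_
  simp only [mul_smul, hF, one_smul]

lemma IsSplitFamily.eq_of_smul_eq (h : IsSplitFamily K q) {M : Type*} [AddCommGroup M]
    [Module S M] {x y : M}
    (hxy : ∀ i (s : S), q i • s • x = q i • s • y) : x = y := by
  obtain ⟨n, t, a, b, hab⟩ := h.full
  rw [← one_smul S x, ← one_smul S y, ← hab, Finset.sum_smul, Finset.sum_smul]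
  exact Finset.sum_congr rfl fun i _ => by simp only [mul_smul, hxy]

/-- Modules are classified by the dimensions of their corners. -/
lemma IsSplitFamily.nonempty_linearEquiv (h : IsSplitFamily K q)
    [Module.Finite K P] [Module.Finite K Q]
    (hr : ∀ i, Module.finrank K (moduleCorner K P (q i)) =
      Module.finrank K (moduleCorner K Q (q i))) :
    Nonempty (P ≃ₗ[S] Q) := by
  let e : ∀ i, moduleCorner K P (q i) ≃ₗ[K] moduleCorner K Q (q i) :=
    fun i => LinearEquiv.ofFinrankEq _ _ (hr i)
  have fixP : ∀ i (x : moduleCorner K P (q i)), q i • (x : P) = x := by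
    rintro i ⟨_, x, rfl⟩
    simp [← mul_smul, h.idem]
  have fixQ : ∀ i (x : moduleCorner K Q (q i)), q i • (x : Q) = x := by
    rintro i ⟨_, x, rfl⟩
    simp [← mul_smul, h.idem]
  let πP : ∀ i, P →ₗ[K] moduleCorner K P (q i) :=
    fun i => LinearMap.rangeRestrict (Algebra.lsmul K K P (q i))
  let πQ : ∀ i, Q →ₗ[K] moduleCorner K Q (q i) :=
    fun i => LinearMap.rangeRestrict (Algebra.lsmul K K Q (q i))
  have πP_smul : ∀ i x, πP i (q i • x) = πP i x := fun i x =>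
    Subtype.ext (by change q i • q i • x = q i • x; rw [← mul_smul, h.idem])
  have πQ_smul : ∀ i x, πQ i (q i • x) = πQ i x := fun i x =>
    Subtype.ext (by change q i • q i • x = q i • x; rw [← mul_smul, h.idem])
  have πP_coe : ∀ i (x : moduleCorner K P (q i)), πP i x = x := fun i x =>
    Subtype.ext (fixP i x)
  have πQ_coe : ∀ i (x : moduleCorner K Q (q i)), πQ i x = x := fun i x =>
    Subtype.ext (fixQ i x)
  obtain ⟨Φ, hΦ⟩ := h.exists_glue
    (fun i => (moduleCorner K Q (q i)).subtype ∘ₗ (e i).toLinearMap ∘ₗ πP i)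
    (fun i x => fixQ i _) (fun i x => by simp [πP_smul])
  obtain ⟨Ψ, hΨ⟩ := h.exists_glue
    (fun i => (moduleCorner K P (q i)).subtype ∘ₗ (e i).symm.toLinearMap ∘ₗ πQ i)
    (fun i x => fixP i _) (fun i x => by simp [πQ_smul])
  refine ⟨LinearEquiv.ofLinearMap Φ Ψ ?_ ?_⟩
  · ext y
    refine h.eq_of_smul_eq fun i s => ?_
    have h1 : q i • s • Φ (Ψ y) = q i • Φ (Ψ (s • y)) := by simp
    simp only [LinearMap.comp_apply, LinearMap.id_apply]
    rw [h1, hΦ]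
    simp only [LinearMap.comp_apply]
    -- `πP i` sees only the component of `Ψ` in the corner of `q i`, where `Ψ` is given by the
    -- inverse of `e i`.
    rw [← πP_smul, hΨ]
    simp only [LinearMap.comp_apply, Submodule.subtype_apply, LinearEquiv.coe_coe, πP_coe,
      LinearEquiv.apply_symm_apply]
    rfl
  · ext y
    refine h.eq_of_smul_eq fun i s => ?_
    have h1 : q i • s • Ψ (Φ y) = q i • Ψ (Φ (s • y)) := by simp
    simp only [LinearMap.comp_apply, LinearMap.id_apply]
    rw [h1, hΨ]
    simp only [LinearMap.comp_apply]
    rw [← πQ_smul, hΦ]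
    simp only [LinearMap.comp_apply, Submodule.subtype_apply, LinearEquiv.coe_coe, πQ_coe,
      LinearEquiv.symm_apply_apply]
    rfl

lemma IsSplitFamily.nonempty_linearEquiv_of_prod (h : IsSplitFamily K q)
    [Module.Finite K P] [Module.Finite K Q] [Module.Finite K T]
    (e : (P × T) ≃ₗ[S] (Q × T)) : Nonempty (P ≃ₗ[S] Q) := by
  refine h.nonempty_linearEquiv (K := K) fun i => ?_
  have := finrank_moduleCorner_congr (K := K) e (q i)
  rw [finrank_moduleCorner_prod, finrank_moduleCorner_prod] at this
  omega

lemma IsSplitFamily.hasCancellationOfProjectives (h : IsSplitFamily K q) :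
    HasCancellationOfProjectives S := by
  rintro P Q _ _ _ _ _ - _ - ⟨e⟩
  -- Scalars act through `Sᵐᵒᵖ`, which is finite-dimensional, so finitely generated modules have
  -- corners of finite dimension.
  let : Module K P := Module.compHom P (algebraMap K Sᵐᵒᵖ)
  let : Module K Q := Module.compHom Q (algebraMap K Sᵐᵒᵖ)
  have : IsScalarTower K Sᵐᵒᵖ P := IsScalarTower.of_algebraMap_smul fun _ _ => rfl
  have : IsScalarTower K Sᵐᵒᵖ Q := IsScalarTower.of_algebraMap_smul fun _ _ => rfl
  have := h.finite
  have := h.op.finite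
  have : Module.Finite K P := Module.Finite.trans Sᵐᵒᵖ P
  have : Module.Finite K Q := Module.Finite.trans Sᵐᵒᵖ Q
  exact h.op.nonempty_linearEquiv_of_prod (K := K) e

end Split

lemma TwoSidedIdeal.exists_sum_eq_of_mem_span_range {S : Type u} {W : Type v} [Ring S]
    {q : W → S} {x : S} (hx : x ∈ TwoSidedIdeal.span (Set.range q)) :
    ∃ (n : ℕ) (t : Fin n → W) (a b : Fin n → S), ∑ i, a i * q (t i) * b i = x := by
  rw [TwoSidedIdeal.mem_span_iff_mem_addSubgroup_closure] at hx
  induction hx using AddSubgroup.closure_induction with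
  | mem x hx =>
    obtain ⟨_, ⟨a, -, _, ⟨i, rfl⟩, rfl⟩, b, -, rfl⟩ := hx
    exact ⟨1, fun _ => i, fun _ => a, fun _ => b, by simp⟩
  | zero => exact ⟨0, Fin.elim0, Fin.elim0, Fin.elim0, by simp⟩
  | add x y _ _ ihx ihy =>
    obtain ⟨n, t, a, b, rfl⟩ := ihx
    obtain ⟨m, t', a', b', rfl⟩ := ihy
    exact ⟨n + m, Fin.append t t', Fin.append a a', Fin.append b b', by
      simp [Fin.sum_univ_add]⟩
  | neg x _ ih =>
    obtain ⟨n, t, a, b, rfl⟩ := ih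
    exact ⟨n, t, fun i => -a i, b, by simp⟩

namespace DirectedGraph

variable {V : Type u} {E : Type v}

/-! ### Acyclic graphs -/

section Acyclic

variable {G : DirectedGraph V E}

/-- A closed path with a repeated source contains a strictly shorter closed path, namely the segment
between the two occurrences; strong induction on the length ends at a cycle. -/
lemma IsAcyclic.not_isClosedPath (hG : G.IsAcyclic) (p : List E) : ¬ G.IsClosedPath p := by
  induction hn : p.length using Nat.strong_induction_on generalizing p with
  | _ n ih =>
    intro hp
    by_cases hd : (p.map G.s).Nodup
    · exact hG ⟨p, hp, hd⟩
    · rw [List.nodup_iff_pairwise_ne, List.pairwise_map] at hd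
      obtain ⟨l₁, a, l₂, b, l₃, rfl, hab⟩ : ∃ l₁ a l₂ b l₃,
          p = l₁ ++ a :: (l₂ ++ b :: l₃) ∧ G.s a = G.s b := by
        clear ih hp hn hG
        induction p with
        | nil => simp at hd
        | cons a l ihl =>
          rw [List.pairwise_cons, not_and_or] at hd
          rcases hd with hd | hd
          · push Not at hd
            obtain ⟨b, hb, hab⟩ := hd
            obtain ⟨l₂, l₃, rfl⟩ := List.append_of_mem hb
            exact ⟨[], a, l₂, b, l₃, rfl, hab⟩
          · obtain ⟨l₁, c, l₂, b, l₃, rfl, h⟩ := ihl hd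
            exact ⟨a :: l₁, c, l₂, b, l₃, rfl, h⟩
      have hc := hp.1.right_of_append
      rw [← List.cons_append, List.isChain_append] at hc
      refine ih (a :: l₂).length (by subst hn; simp; omega) (a :: l₂) rfl
        ⟨hc.1, List.cons_ne_nil _ _, ?_⟩
      rw [List.head_cons, hab]
      exact hc.2.2 _ (List.getLast_mem_getLast? _) _ rfl

lemma exists_path_of_transGen {x y : V}
    (h : Relation.TransGen (fun x y => ∃ e, G.s e = x ∧ G.r e = y) x y) :
    ∃ p : List E, p.IsChain (fun e f => G.r e = G.s f) ∧
      ∃ h : p ≠ [], G.r (p.getLast h) = y ∧ G.s (p.head h) = x := by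
  induction h using Relation.TransGen.head_induction_on with
  | single h =>
    obtain ⟨e, rfl, rfl⟩ := h
    exact ⟨[e], List.isChain_singleton _, List.cons_ne_nil _ _, rfl, rfl⟩
  | head h _ ih =>
    obtain ⟨e, rfl, he⟩ := h
    obtain ⟨p, hp, hne, hl, hh⟩ := ih
    cases p with
    | nil => exact absurd rfl hne
    | cons f p =>
      refine ⟨e :: f :: p, List.IsChain.cons_cons (he.trans hh.symm) hp, List.cons_ne_nil _ _, ?_, rfl⟩
      rw [List.getLast_cons hne, hl]

/-- Ranges lie below sources, so induction proves a claim at a vertex from the ranges of its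
outgoing edges. On a finite set it suffices that the transitive closure is irreflexive, and a
reflexive pair would be a closed path. -/
lemma IsAcyclic.wellFounded [Finite V] (hG : G.IsAcyclic) :
    WellFounded fun y x => ∃ e, G.s e = x ∧ G.r e = y := by
  have hirr : Std.Irrefl
      (fun y x => Relation.TransGen (fun x y => ∃ e, G.s e = x ∧ G.r e = y) x y) := by
    refine ⟨fun x hx => ?_⟩
    obtain ⟨p, hp, hne, hl, hh⟩ := exists_path_of_transGen hx
    exact hG.not_isClosedPath p ⟨hp, hne, hl.trans hh.symm⟩
  have htr : IsTrans V
      (fun y x => Relation.TransGen (fun x y => ∃ e, G.s e = x ∧ G.r e = y) x y) :=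
    ⟨fun _ _ _ h₁ h₂ => h₂.trans h₁⟩
  exact Subrelation.wf (fun {_ _} h => .single h)
    (Finite.wellFounded_of_trans_of_irrefl
      (fun y x => Relation.TransGen (fun x y => ∃ e, G.s e = x ∧ G.r e = y) x y))

end Acyclic

/-! ### Generators of the Cohn path algebra -/

namespace CohnPathAlgebra

variable (K : Type w) [Field K] [Fintype V] (G : DirectedGraph V E)

/-- The quotient map from the free algebra. -/
noncomputable def mk : FreeAlgebra K (CohnGen V E) →ₐ[K] CohnPathAlgebra K G :=
  RingQuot.mkAlgHom K (CohnRel K G)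

/-- A vertex in the Cohn path algebra. -/
noncomputable def vertex (x : V) : CohnPathAlgebra K G := mk K G (freeVertex K x)

/-- An edge in the Cohn path algebra. -/
noncomputable def edge (e : E) : CohnPathAlgebra K G := mk K G (freeEdge K e)

/-- The adjoint of an edge in the Cohn path algebra. -/
noncomputable def ghost (e : E) : CohnPathAlgebra K G := mk K G (freeGhost K e)

variable {K G}

lemma mk_eq_of_rel {x y : FreeAlgebra K (CohnGen V E)} (h : CohnRel K G x y) :
    mk K G x = mk K G y :=
  RingQuot.mkAlgHom_rel K h

lemma vertex_mul_self (x : V) : vertex K G x * vertex K G x = vertex K G x := by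
  simpa only [map_mul, vertex, edge, ghost] using mk_eq_of_rel (CohnRel.vertex_mul_self (K := K) (G := G) x)

lemma vertex_mul_of_ne {x y : V} (h : x ≠ y) : vertex K G x * vertex K G y = 0 := by
  simpa only [map_mul, map_zero, vertex, edge, ghost] using
    mk_eq_of_rel (CohnRel.vertex_mul_of_ne (K := K) (G := G) x y h)

lemma source_mul_edge (e : E) : vertex K G (G.s e) * edge K G e = edge K G e := by
  simpa only [map_mul, vertex, edge, ghost] using mk_eq_of_rel (CohnRel.source_mul_edge (K := K) (G := G) e)

lemma edge_mul_range (e : E) : edge K G e * vertex K G (G.r e) = edge K G e := by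
  simpa only [map_mul, vertex, edge, ghost] using mk_eq_of_rel (CohnRel.edge_mul_range (K := K) (G := G) e)

lemma range_mul_ghost (e : E) : vertex K G (G.r e) * ghost K G e = ghost K G e := by
  simpa only [map_mul, vertex, edge, ghost] using mk_eq_of_rel (CohnRel.range_mul_ghost (K := K) (G := G) e)

lemma ghost_mul_source (e : E) : ghost K G e * vertex K G (G.s e) = ghost K G e := by
  simpa only [map_mul, vertex, edge, ghost] using mk_eq_of_rel (CohnRel.ghost_mul_source (K := K) (G := G) e)

lemma ghost_mul_edge_self (e : E) : ghost K G e * edge K G e = vertex K G (G.r e) := by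
  simpa only [map_mul, vertex, edge, ghost] using mk_eq_of_rel (CohnRel.ghost_mul_edge_self (K := K) (G := G) e)

lemma ghost_mul_edge_of_ne {e f : E} (h : e ≠ f) : ghost K G e * edge K G f = 0 := by
  simpa only [map_mul, map_zero, vertex, edge, ghost] using
    mk_eq_of_rel (CohnRel.ghost_mul_edge_of_ne (K := K) (G := G) e f h)

variable (K G) in
lemma sum_vertex : ∑ x, vertex K G x = 1 := by
  simpa only [map_sum, map_one, vertex] using mk_eq_of_rel (CohnRel.sum_vertex (K := K) (G := G))

lemma vertex_mul_edge_of_ne {x : V} {e : E} (h : x ≠ G.s e) :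
    vertex K G x * edge K G e = 0 := by
  rw [← source_mul_edge, ← mul_assoc, vertex_mul_of_ne h, zero_mul]

lemma ghost_mul_vertex_of_ne {x : V} {e : E} (h : x ≠ G.s e) :
    ghost K G e * vertex K G x = 0 := by
  rw [← ghost_mul_source, mul_assoc, vertex_mul_of_ne h.symm, mul_zero]

/-- A subspace stable under left multiplication by the generators is a left ideal. -/
lemma mul_mem_of_generators (T : Submodule K (CohnPathAlgebra K G))
    (hv : ∀ x, ∀ t ∈ T, vertex K G x * t ∈ T) (he : ∀ e, ∀ t ∈ T, edge K G e * t ∈ T)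
    (hg : ∀ e, ∀ t ∈ T, ghost K G e * t ∈ T) (a : CohnPathAlgebra K G) :
    ∀ t ∈ T, a * t ∈ T := by
  obtain ⟨a, rfl⟩ := RingQuot.mkAlgHom_surjective K (CohnRel K G) a
  change ∀ t ∈ T, mk K G a * t ∈ T
  induction a using FreeAlgebra.induction with
  | grade0 r =>
    intro t ht
    rw [AlgHom.commutes, ← Algebra.smul_def]
    exact T.smul_mem r ht
  | grade1 x =>
    cases x with
    | vertex x => exact hv x
    | edge e => exact he e
    | ghost e => exact hg e
  | mul a b ha hb =>
    intro t ht
    rw [map_mul, mul_assoc]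
    exact ha _ (hb t ht)
  | add a b ha hb =>
    intro t ht
    rw [map_add, add_mul]
    exact T.add_mem (ha t ht) (hb t ht)

/-! ### The gap projections -/

open Classical in
variable (K G) in
/-- The idempotent `x - ∑ e e*`, where `e` ranges over the edges with source `x`. -/
noncomputable def gap [Fintype E] (x : V) : CohnPathAlgebra K G :=
  vertex K G x - ∑ e with G.s e = x, edge K G e * ghost K G e

section Gap

variable [Fintype E]

lemma vertex_mul_gap_self (x : V) : vertex K G x * gap K G x = gap K G x := by
  classical
  rw [gap, mul_sub, vertex_mul_self, Finset.mul_sum]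
  congr 1
  refine Finset.sum_congr rfl fun e he => ?_
  rw [← (Finset.mem_filter.1 he).2, ← mul_assoc, source_mul_edge]

lemma vertex_mul_gap_of_ne {x y : V} (h : x ≠ y) : vertex K G x * gap K G y = 0 := by
  rw [← vertex_mul_gap_self, ← mul_assoc, vertex_mul_of_ne h, zero_mul]

lemma gap_mul_vertex_self (x : V) : gap K G x * vertex K G x = gap K G x := by
  classical
  rw [gap, sub_mul, vertex_mul_self, Finset.sum_mul]
  congr 1
  refine Finset.sum_congr rfl fun e he => ?_
  rw [← (Finset.mem_filter.1 he).2, mul_assoc, ghost_mul_source]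

/-- Only the term `e e*` of the sum survives, and `e* e e* = e*` cancels against `e* * s(e)`. -/
lemma ghost_mul_gap (e : E) (x : V) : ghost K G e * gap K G x = 0 := by
  classical
  by_cases hx : x = G.s e
  · subst hx
    rw [gap, mul_sub, ghost_mul_source, Finset.mul_sum, Finset.sum_eq_single e]
    · rw [← mul_assoc, ghost_mul_edge_self, range_mul_ghost, sub_self]
    · intro f _ hf
      rw [← mul_assoc, ghost_mul_edge_of_ne hf.symm, zero_mul]
    · simp
  · rw [← vertex_mul_gap_self, ← mul_assoc, ghost_mul_vertex_of_ne hx, zero_mul]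

lemma gap_mul_edge (e : E) (x : V) : gap K G x * edge K G e = 0 := by
  classical
  by_cases hx : x = G.s e
  · subst hx
    rw [gap, sub_mul, source_mul_edge, Finset.sum_mul, Finset.sum_eq_single e]
    · rw [mul_assoc, ghost_mul_edge_self, edge_mul_range, sub_self]
    · intro f _ hf
      rw [mul_assoc, ghost_mul_edge_of_ne hf, mul_zero]
    · simp
  · rw [← gap_mul_vertex_self, mul_assoc, vertex_mul_edge_of_ne hx, mul_zero]

lemma gap_mul_self (x : V) : gap K G x * gap K G x = gap K G x := by
  conv_lhs => enter [2]; rw [gap]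
  rw [mul_sub, gap_mul_vertex_self, Finset.mul_sum, Finset.sum_eq_zero, sub_zero]
  intro e _
  rw [← mul_assoc, gap_mul_edge, zero_mul]

/-- The elements `α q`, where `α` is a path and `q` is the gap projection at `x`. -/
inductive IsPathMulGap (G : DirectedGraph V E) (K : Type w) [Field K] [Fintype V] [Fintype E]
    (x : V) : CohnPathAlgebra K G → Prop
  | gap : IsPathMulGap G K x (gap K G x)
  | edge_mul (e : E) {t : CohnPathAlgebra K G} (ht : IsPathMulGap G K x t) :
      IsPathMulGap G K x (edge K G e * t)

lemma IsPathMulGap.vertex_mul {x : V} {t : CohnPathAlgebra K G} (ht : IsPathMulGap G K x t)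
    (y : V) : vertex K G y * t = 0 ∨ vertex K G y * t = t := by
  cases ht with
  | gap =>
    by_cases h : y = x
    · subst h; exact Or.inr (vertex_mul_gap_self _)
    · exact Or.inl (vertex_mul_gap_of_ne h)
  | edge_mul e ht =>
    rw [← mul_assoc]
    by_cases h : y = G.s e
    · subst h; rw [source_mul_edge]; exact Or.inr rfl
    · rw [vertex_mul_edge_of_ne h, zero_mul]; exact Or.inl rfl

/-- The span of the `α q` is a left ideal: a ghost edge cancels or kills the first edge of `α`, and
kills `q` itself when `α` is empty. -/
lemma mul_gap_mem_span (x : V) (a : CohnPathAlgebra K G) :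
    a * gap K G x ∈ Submodule.span K {t | IsPathMulGap G K x t} := by
  have lift : ∀ y : CohnPathAlgebra K G,
      (∀ t, IsPathMulGap G K x t → y * t ∈ Submodule.span K {t | IsPathMulGap G K x t}) →
      ∀ t ∈ Submodule.span K {t | IsPathMulGap G K x t},
        y * t ∈ Submodule.span K {t | IsPathMulGap G K x t} := by
    intro y hy
    change Submodule.span K {t | IsPathMulGap G K x t} ≤
      (Submodule.span K {t | IsPathMulGap G K x t}).comap (LinearMap.mulLeft K y)
    exact Submodule.span_le.2 hy
  have hv : ∀ y t, IsPathMulGap G K x t →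
      vertex K G y * t ∈ Submodule.span K {t | IsPathMulGap G K x t} := by
    intro y t ht
    rcases ht.vertex_mul y with h | h <;> rw [h]
    · exact Submodule.zero_mem _
    · exact Submodule.subset_span ht
  refine mul_mem_of_generators _ (fun y => lift _ (hv y)) (fun e => lift _ fun t ht => ?_)
    (fun e => lift _ fun t ht => ?_) a _ (Submodule.subset_span .gap)
  · exact Submodule.subset_span (.edge_mul e ht)
  · cases ht with
    | gap => rw [ghost_mul_gap]; exact Submodule.zero_mem _
    | @edge_mul f t ht =>
      rw [← mul_assoc]
      by_cases h : e = f
      · subst h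
        rw [ghost_mul_edge_self]
        exact hv _ _ ht
      · rw [ghost_mul_edge_of_ne h, zero_mul]
        exact Submodule.zero_mem _

/-- In the span of the `α q`, left multiplication by a gap kills every `α` of positive length. -/
lemma gap_mul_mul_gap_mem (x y : V) (a : CohnPathAlgebra K G) :
    gap K G x * a * gap K G y ∈ Submodule.span K {gap K G x * gap K G y} := by
  rw [mul_assoc]
  have h : Submodule.span K {t | IsPathMulGap G K y t} ≤
      (Submodule.span K {gap K G x * gap K G y}).comap (LinearMap.mulLeft K (gap K G x)) := by
    refine Submodule.span_le.2 fun t ht => ?_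
    change gap K G x * t ∈ Submodule.span K {gap K G x * gap K G y}
    cases ht with
    | gap => exact Submodule.mem_span_singleton_self _
    | edge_mul e ht =>
      rw [← mul_assoc, gap_mul_edge, zero_mul]
      exact Submodule.zero_mem _
  exact h (mul_gap_mem_span y a)

lemma gap_mul_gap_of_ne {x y : V} (h : x ≠ y) : gap K G x * gap K G y = 0 := by
  rw [← gap_mul_vertex_self, mul_assoc, vertex_mul_gap_of_ne h, mul_zero]

/-- In an acyclic graph, the gap projections generate the unit ideal. -/
lemma vertex_mem_span_gap (hG : G.IsAcyclic) (x : V) :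
    vertex K G x ∈ TwoSidedIdeal.span (Set.range (gap K G)) := by
  classical
  induction x using hG.wellFounded.induction with
  | _ x ih =>
    have hx : vertex K G x =
        gap K G x + ∑ e with G.s e = x, edge K G e * vertex K G (G.r e) * ghost K G e := by
      simp only [edge_mul_range]
      exact (sub_add_cancel _ _).symm
    rw [hx]
    refine TwoSidedIdeal.add_mem _ (TwoSidedIdeal.subset_span ⟨x, rfl⟩)
      (sum_mem fun e he => ?_)
    exact TwoSidedIdeal.mul_mem_right _ _ _ (TwoSidedIdeal.mul_mem_left _ _ _
      (ih _ ⟨e, (Finset.mem_filter.1 he).2, rfl⟩))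

lemma isSplitFamily_gap (hG : G.IsAcyclic) : IsSplitFamily K (gap K G) where
  idem := gap_mul_self
  corner_ne x y h a := by
    simpa [gap_mul_gap_of_ne h] using gap_mul_mul_gap_mem x y a
  corner_self x a := by
    obtain ⟨c, hc⟩ := Submodule.mem_span_singleton.1 (gap_mul_mul_gap_mem x x a)
    exact ⟨c, by rw [← hc, gap_mul_self]⟩
  full := by
    refine TwoSidedIdeal.exists_sum_eq_of_mem_span_range ?_
    rw [← sum_vertex K G]
    exact sum_mem fun x _ => vertex_mem_span_gap hG x

end Gap

end CohnPathAlgebra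

end DirectedGraph

namespace DirectedGraph

variable {V : Type u} {E : Type v}

/-! ### The path representation -/

namespace CohnPathAlgebra

section Representation

variable (G : DirectedGraph V E) (K : Type w) [Field K]

/-- The start of a word of edges that ends at a given vertex. -/
def wordStart : List E × V → V
  | ([], x) => x
  | (e :: _, _) => G.s e

lemma wordStart_cons (e : E) (l : List E) (x : V) : wordStart G (e :: l, x) = G.s e := rfl

/-- The linear map on the free module on words given by a partially defined map of words. -/
noncomputable def partialMap (f : List E × V → Option (List E × V)) :
    Module.End K ((List E × V) →₀ K) :=
  Finsupp.lift _ K _ fun x => (f x).elim 0 fun y => Finsupp.single y 1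

@[simp] lemma partialMap_single (f : List E × V → Option (List E × V)) (x : List E × V) :
    partialMap K f (Finsupp.single x 1) = (f x).elim 0 fun y => Finsupp.single y 1 := by
  simp [partialMap]

open Classical in
/-- Generators act on words: vertices by restriction, edges by left multiplication, and their
adjoints by left cancellation. -/
noncomputable def wordAction : CohnGen V E → List E × V → Option (List E × V)
  | .vertex x, p => if wordStart G p = x then some p else none
  | .edge e, p => if wordStart G p = G.r e then some (e :: p.1, p.2) else none
  -- Ghost edges kill empty words, even where the vertex emits edges; this separates `x` from `∑ e
  -- e*`.
  | .ghost _, ([], _) => none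
  -- Words need not be composable, so the condition on the start of `l` is what secures `r(e) e* =
  -- e*`.
  | .ghost e, (f :: l, x) => if e = f ∧ wordStart G (l, x) = G.r e then some (l, x) else none

variable [Fintype V]

/-- The representation of the Cohn path algebra on words of edges. -/
noncomputable def wordRep : CohnPathAlgebra K G →ₐ[K] Module.End K ((List E × V) →₀ K) :=
  RingQuot.liftAlgHom K ⟨FreeAlgebra.lift K fun g => partialMap K (wordAction G g), by
    intro a b hab
    refine Finsupp.lhom_ext' fun p => LinearMap.ext_ring ?_
    obtain ⟨l, y⟩ := p
    cases hab with
    | vertex_mul_self x =>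
      by_cases h : wordStart G (l, y) = x <;> simp [freeVertex, wordAction, h]
    | vertex_mul_of_ne x x' h =>
      by_cases h' : wordStart G (l, y) = x'
      · subst h'; simp [freeVertex, wordAction, h.symm]
      · simp [freeVertex, wordAction, h']
    | source_mul_edge e =>
      by_cases h : wordStart G (l, y) = G.r e <;>
        simp [freeVertex, freeEdge, wordAction, h, wordStart_cons]
    | edge_mul_range e =>
      by_cases h : wordStart G (l, y) = G.r e <;>
        simp [freeVertex, freeEdge, wordAction, h]
    | range_mul_ghost e =>
      cases l with
      | nil => simp [freeVertex, freeGhost, wordAction]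
      | cons f l =>
        by_cases h : e = f ∧ wordStart G (l, y) = G.r e <;>
          simp [freeVertex, freeGhost, wordAction, h]
    | ghost_mul_source e =>
      cases l with
      | nil =>
        by_cases h : y = G.s e <;> simp [freeVertex, freeGhost, wordAction, wordStart, h]
      | cons f l =>
        by_cases h : e = f
        · subst h
          by_cases h' : wordStart G (l, y) = G.r e <;>
            simp [freeVertex, freeGhost, wordAction, wordStart_cons, h']
        · by_cases h' : G.s f = G.s e <;>
            simp [freeVertex, freeGhost, wordAction, wordStart_cons, h, h']
    | ghost_mul_edge_self e =>
      by_cases h : wordStart G (l, y) = G.r e <;>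
        simp [freeVertex, freeEdge, freeGhost, wordAction, h]
    | ghost_mul_edge_of_ne e f hef =>
      by_cases h : wordStart G (l, y) = G.r f <;>
        simp [freeEdge, freeGhost, wordAction, h, hef]
    | sum_vertex =>
      simp only [map_sum, freeVertex, FreeAlgebra.lift_ι_apply, LinearMap.comp_apply,
        LinearMap.sum_apply, Finsupp.lsingle_apply, partialMap_single, wordAction, map_one,
        Module.End.one_apply]
      rw [Finset.sum_eq_single (wordStart G (l, y))]
      · simp
      · intro x _ hx
        simp [hx.symm]
      · simp⟩

lemma wordRep_mk_ι (g : CohnGen V E) :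
    wordRep G K (mk K G (FreeAlgebra.ι K g)) = partialMap K (wordAction G g) := by
  rw [wordRep, mk]
  exact (RingQuot.liftAlgHom_mkAlgHom_apply K _ _ _).trans (FreeAlgebra.lift_ι_apply _ _)

lemma wordRep_vertex (x : V) :
    wordRep G K (vertex K G x) (Finsupp.single ([], x) 1) = Finsupp.single ([], x) 1 := by
  rw [vertex, freeVertex, wordRep_mk_ι]
  simp [wordAction, wordStart]

lemma wordRep_ghost (e : E) (x : V) :
    wordRep G K (ghost K G e) (Finsupp.single ([], x) 1) = 0 := by
  rw [ghost, freeGhost, wordRep_mk_ι]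
  simp [wordAction]

lemma vertex_ne_mul_ghost (x : V) (a : CohnPathAlgebra K G) (e : E) :
    vertex K G x ≠ a * ghost K G e := by
  intro h
  have h1 := wordRep_vertex G K x
  rw [h, map_mul, Module.End.mul_apply, wordRep_ghost, map_zero] at h1
  exact Finsupp.single_ne_zero.2 one_ne_zero h1.symm

lemma nontrivial [Nonempty V] : Nontrivial (CohnPathAlgebra K G) := by
  obtain ⟨x⟩ := ‹Nonempty V›
  refine ⟨vertex K G x, 0, fun h => ?_⟩
  have h1 := wordRep_vertex G K x
  rw [h, map_zero, LinearMap.zero_apply] at h1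
  exact Finsupp.single_ne_zero.2 one_ne_zero h1.symm

end Representation

/-! ### Closed paths and direct finiteness -/

section DirectlyFinite

variable {G : DirectedGraph V E} {K : Type w} [Field K] [Fintype V]

lemma source_mul_path (e : E) (p : List E) :
    vertex K G (G.s e) * ((e :: p).map (edge K G)).prod = ((e :: p).map (edge K G)).prod := by
  rw [List.map_cons, List.prod_cons, ← mul_assoc, source_mul_edge]

lemma path_mul_range (p : List E) (hp : p ≠ []) :
    (p.map (edge K G)).prod * vertex K G (G.r (p.getLast hp)) = (p.map (edge K G)).prod := by
  conv_lhs => enter [1]; rw [← List.dropLast_append_getLast hp]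
  conv_rhs => rw [← List.dropLast_append_getLast hp]
  simp [mul_assoc, edge_mul_range]

lemma ghostPath_mul_source (e : E) (p : List E) :
    ((e :: p).reverse.map (ghost K G)).prod * vertex K G (G.s e) =
      ((e :: p).reverse.map (ghost K G)).prod := by
  simp [mul_assoc, ghost_mul_source]

lemma range_mul_ghostPath (p : List E) (hp : p ≠ []) :
    vertex K G (G.r (p.getLast hp)) * (p.reverse.map (ghost K G)).prod =
      (p.reverse.map (ghost K G)).prod := by
  conv_lhs => enter [2]; rw [← List.dropLast_append_getLast hp]
  conv_rhs => rw [← List.dropLast_append_getLast hp]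
  simp [← mul_assoc, range_mul_ghost]

/-- The product telescopes from the middle: `e* e = r(e)` is the source of the next edge, which
absorbs it. -/
lemma ghostPath_mul_path (p : List E) (hp : p ≠ [])
    (hc : p.IsChain (fun e f => G.r e = G.s f)) :
    (p.reverse.map (ghost K G)).prod * (p.map (edge K G)).prod =
      vertex K G (G.r (p.getLast hp)) := by
  induction p with
  | nil => exact absurd rfl hp
  | cons e p ih =>
    cases p with
    | nil => simp [ghost_mul_edge_self]
    | cons f p =>
      rw [List.isChain_cons_cons] at hc
      rw [List.getLast_cons (List.cons_ne_nil f p), ← ih (List.cons_ne_nil f p) hc.2,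
        List.reverse_cons, List.map_append, List.prod_append, List.map_cons (l := f :: p),
        List.prod_cons, mul_assoc]
      congr 1
      rw [List.map_singleton, List.prod_singleton, ← mul_assoc, ghost_mul_edge_self, hc.1,
        source_mul_path]

lemma isAcyclic_of_isDedekindFiniteMonoid
    (h : IsDedekindFiniteMonoid (CohnPathAlgebra K G)) : G.IsAcyclic := by
  rintro ⟨p, ⟨hc, hne, hl⟩, -⟩
  cases p with
  | nil => exact hne rfl
  | cons e p =>
    rw [List.head_cons] at hl
    have h1 := source_mul_path (K := K) (G := G) e p
    have h2 := path_mul_range (K := K) (G := G) _ hne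
    have h3 := ghostPath_mul_source (K := K) (G := G) e p
    have h4 := range_mul_ghostPath (K := K) (G := G) _ hne
    have h5 := ghostPath_mul_path (K := K) (G := G) _ hne hc
    rw [hl] at h2 h4 h5
    set c := ((e :: p).map (edge K G)).prod
    set d := ((e :: p).reverse.map (ghost K G)).prod with hd
    set x := vertex K G (G.s e) with hx
    have hxx : x * x = x := vertex_mul_self _
    -- Both `c` and `d` lie in the corner of `x`; adding `1 - x` turns the relation `d * c = x`
    -- there into one about `1`.
    have hdc : (d + (1 - x)) * (c + (1 - x)) = 1 := by
      simp only [mul_add, add_mul, mul_sub, sub_mul, mul_one, one_mul, h1, h3, h5, hxx]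
      abel
    have hcd := h.mul_eq_one_symm hdc
    have hx' : x = c * d := by
      simp only [mul_add, add_mul, mul_sub, sub_mul, mul_one, one_mul, h2, h4, hxx] at hcd
      rw [← sub_eq_zero] at hcd ⊢
      rw [← neg_eq_zero, ← hcd]
      abel
    -- The rightmost factor of `d` is the adjoint of the first edge `e`.
    refine vertex_ne_mul_ghost G K (G.s e) (c * (p.reverse.map (ghost K G)).prod) e ?_
    rw [← hx, hx', hd]
    simp [mul_assoc]

end DirectlyFinite

end CohnPathAlgebra

end DirectedGraph

theorem corollary5p4 {V : Type u} {E : Type v} [Fintype V] [Nonempty V] [Finite E]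
    (G : DirectedGraph V E) (K : Type w) [Field K] :
    List.TFAE [
      HasCancellationOfProjectives (DirectedGraph.CohnPathAlgebra K G),
      IsHermiteRing (DirectedGraph.CohnPathAlgebra K G),
      IsStablyFinite (DirectedGraph.CohnPathAlgebra K G),
      IsDedekindFiniteMonoid (DirectedGraph.CohnPathAlgebra K G),
      G.IsAcyclic] := by
  have := DirectedGraph.CohnPathAlgebra.nontrivial G K
  have := Fintype.ofFinite E
  tfae_have 1 → 2 := HasCancellationOfProjectives.isHermiteRing
  tfae_have 2 → 3 := IsHermiteRing.isStablyFinite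
  tfae_have 3 → 4 := IsStablyFinite.isDedekindFiniteMonoid
  tfae_have 4 → 5 := DirectedGraph.CohnPathAlgebra.isAcyclic_of_isDedekindFiniteMonoid
  tfae_have 5 → 1 := fun hG =>
    (DirectedGraph.CohnPathAlgebra.isSplitFamily_gap (K := K) hG).hasCancellationOfProjectives
  tfae_finish
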